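/- A group $G$ is of type $FP_m$ if the trivial $\mathbb{Z}G$-module $\mathbb{Z}$ has a projective resolution $\cdots \to P_1 \to P_0 \to \mathbb{Z} \to 0$ in which $P_i$ is a finitely generated $\mathbb{Z}G$-module for all $i \le m$. Let $n \ge 1$ be a natural number, and let $N_1 \hookrightarrow G_1 \stackrel{\pi_1}{\twoheadrightarrow} Q$ and $N_2 \hookrightarrow G_2 \stackrel{\pi_2}{\twoheadrightarrow} Q$ be short exact sequences of groups such that $G_1$ and $G_2$ are of type $FP_{n+1}$, $N_1$ is of type $FP_n$, and the second sequence splits, i.e. there is a group homomorphism $\sigma \colon Q \to G_2$ with $\pi_2 \circ \sigma = \mathrm{id}_Q$. Then the fibre product $$P = \{(g_1, g_2) \in G_1 \times G_2 : \pi_1(g_1) = \pi_2(g_2)\}$$ is of type $FP_{n+1}$. No finiteness condition is imposed on $Q$; in particular this holds when $Q$ is of type $FP_{n+2}$, so the Homological $n$-$(n+1)$-$(n+2)$ Conjecture (the same assertion with "the second sequence splits" replaced by "$Q$ is of type $FP_{n+2}$") holds whenever the second sequence splits. -/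

import Mathlib

universe u v

/-- A projective resolution `⋯ → X 2 → X 1 → X 0 → M → 0` of a left module `M` over an associative
ring `S` with `1`. -/
structure ModuleProjectiveResolution (S : Type u) [Ring S] (M : Type v) [AddCommGroup M]
    [Module S M] where
  /-- the modules of the resolution -/
  X : ℕ → Type (max u v)
  [addCommGroup : ∀ i, AddCommGroup (X i)]
  [module : ∀ i, Module S (X i)]
  /-- the differentials -/
  d : ∀ i, X (i + 1) →ₗ[S] X i
  /-- the augmentation -/
  ε : X 0 →ₗ[S] M
  projective : ∀ i, Module.Projective S (X i)
  surjective : Function.Surjective ε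
  exact_zero : Function.Exact (d 0) ε
  exact_succ : ∀ i, Function.Exact (d (i + 1)) (d i)

attribute [instance] ModuleProjectiveResolution.addCommGroup ModuleProjectiveResolution.module

/-- The `S`-module `M` is of type `FP_n`: it has a projective resolution whose modules are finitely
generated in all degrees `i ≤ n`. -/
def ModuleOfTypeFP (S : Type u) [Ring S] (M : Type v) [AddCommGroup M] [Module S M] (n : ℕ) :
    Prop :=
  ∃ R : ModuleProjectiveResolution S M, ∀ i ≤ n, Module.Finite S (R.X i)

/-- The group `G` is of type `FP_n`: the trivial `ℤG`-module `ℤ` is of type `FP_n`. -/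
def GroupOfTypeFP (G : Type u) [Group G] (n : ℕ) : Prop :=
  ModuleOfTypeFP (MonoidAlgebra ℤ G) (Representation.trivial ℤ G ℤ).asModule n

/-- The fibre product `{(g, h) | f₁ g = f₂ h}` of two group homomorphisms, as a subgroup of
`G₁ × G₂`. -/
def fibreProduct {G₁ G₂ Q : Type*} [Group G₁] [Group G₂] [Group Q] (f₁ : G₁ →* Q) (f₂ : G₂ →* Q) :
    Subgroup (G₁ × G₂) where
  carrier := {p | f₁ p.1 = f₂ p.2}
  one_mem' := by simp
  mul_mem' := by
    intro a b ha hb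
    simp only [Set.mem_ofPred_eq] at ha hb ⊢
    simp [ha, hb]
  inv_mem' := by
    intro a ha
    simp only [Set.mem_ofPred_eq] at ha ⊢
    simp [ha]

/-! Projection to `G₂` makes `P` an extension of `G₂` by `N₁`. A splitting `σ` embeds `G₁` in `P` as
the graph `g ↦ (g, σ (π₁ g))`, a subgroup containing `N₁ × 1`. It therefore suffices to treat `N ≤ H
≤ G` with `N` normal of type `FP_n`, and with `H` and `K = G ⧸ N` of type `FP_{n+1}`
(`groupOfTypeFP_of_extension_of_subgroup`).

A group is of type `FP_{n+1}` iff its augmentation ideal is of type `FP_n`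
(`groupOfTypeFP_succ_iff`). Let `I` be the augmentation ideal of `G`, and let `A ≤ B ≤ I` be the
left ideals generated by those of `N` and `H`. Flat base change gives `A` type `FP_{n-1}` and `B`
type `FP_n`. The quotient `I ⧸ A` is the augmentation ideal of `K`. It is `FP_n` over `ℤG` because
`ℤK = ℤG ⧸ A` is. So `B ⧸ A`, then `I ⧸ B = (I ⧸ A) ⧸ (B ⧸ A)`, then `I` are `FP_n`
(`Module.FP.of_submodules`). The extension of `I ⧸ A` by `A` alone would lose one degree; `B`
recovers it. -/

/-- A submodule `K` of `S ^ k` is of type `FP_n`, by recursion on `n`: it is finitely generated,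
and the kernel of some finite free cover of `K` is of type `FP_{n-1}`. -/
def Submodule.SyzygyFP {S : Type*} [Ring S] : ℕ → ∀ {k : ℕ}, Submodule S (Fin k → S) → Prop
  | 0, _, K => K.FG
  | n + 1, k, K => ∃ (l : ℕ) (f : (Fin l → S) →ₗ[S] (Fin k → S)),
      LinearMap.range f = K ∧ Submodule.SyzygyFP n (LinearMap.ker f)

/-- Type `FP_n` by iterated finite free covers, in a form that does not involve universes. -/
def Module.FP (S : Type*) [Ring S] : ℕ → ∀ (M : Type*) [AddCommGroup M] [Module S M], Prop
  | 0, M, _, _ => Module.Finite S M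
  | n + 1, M, _, _ => ∃ (l : ℕ) (f : (Fin l → S) →ₗ[S] M),
      Function.Surjective f ∧ Submodule.SyzygyFP n (LinearMap.ker f)

/-! ### Closure properties of modules of type `FP_n`. -/

namespace Module.FP

variable {S : Type*} [Ring S]
variable {A B C : Type*} [AddCommGroup A] [Module S A] [AddCommGroup B] [Module S B]
  [AddCommGroup C] [Module S C]

theorem syzygyFP_iff {n k : ℕ} (K : Submodule S (Fin k → S)) :
    Submodule.SyzygyFP n K ↔ Module.FP S n K := by
  cases n with
  | zero => exact (Module.Finite.iff_fg (N := K)).symm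
  | succ n =>
    constructor
    · rintro ⟨l, f, rfl, h⟩
      refine ⟨l, f.rangeRestrict, f.surjective_rangeRestrict, ?_⟩
      rwa [LinearMap.ker_rangeRestrict]
    · rintro ⟨l, f, hf, h⟩
      refine ⟨l, K.subtype ∘ₗ f, ?_, ?_⟩
      · rw [LinearMap.range_comp, LinearMap.range_eq_top.2 hf, Submodule.map_top,
          Submodule.range_subtype]
      · rwa [LinearMap.ker_comp, Submodule.ker_subtype]

theorem succ_iff {n : ℕ} : Module.FP S (n + 1) A ↔ ∃ (l : ℕ) (f : (Fin l → S) →ₗ[S] A),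
    Function.Surjective f ∧ Module.FP S n (LinearMap.ker f) := by
  simp only [← syzygyFP_iff]
  rfl

theorem of_equiv {n : ℕ} (e : A ≃ₗ[S] B) (h : Module.FP S n A) : Module.FP S n B := by
  cases n with
  | zero =>
    have : Module.Finite S A := h
    exact Module.Finite.equiv e
  | succ n =>
    obtain ⟨l, f, hf, h⟩ := h
    refine ⟨l, e.toLinearMap ∘ₗ f, e.surjective.comp hf, ?_⟩
    rwa [LinearEquiv.ker_comp]

theorem of_surjective {n l : ℕ} {F : Type*} [AddCommGroup F] [Module S F]
    (e : (Fin l → S) ≃ₗ[S] F) (f : F →ₗ[S] A) (hf : Function.Surjective f)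
    (h : Module.FP S n (LinearMap.ker f)) : Module.FP S (n + 1) A := by
  refine succ_iff.2 ⟨l, f ∘ₗ e.toLinearMap, hf.comp e.surjective, of_equiv ?_ h⟩
  refine e.symm.ofSubmodules _ _ ?_
  ext x
  simp

theorem finite {n : ℕ} (h : Module.FP S n A) : Module.Finite S A := by
  cases n with
  | zero => exact h
  | succ n =>
    obtain ⟨l, f, hf, -⟩ := h
    exact Module.Finite.of_surjective f hf

theorem of_succ {n : ℕ} (h : Module.FP S (n + 1) A) : Module.FP S n A := by
  cases n with
  | zero => exact h.finite
  | succ n =>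
    obtain ⟨l, f, hf, h⟩ := h
    refine ⟨l, f, hf, ?_⟩
    -- The kernel becomes an arbitrary submodule of a free module, so that the induction can pass to
    -- the next syzygy.
    generalize LinearMap.ker f = K at h
    clear hf f
    induction n generalizing l with
    | zero => exact Module.Finite.iff_fg.1 ((syzygyFP_iff K).1 h).finite
    | succ n ih =>
      obtain ⟨l', f, hf, h⟩ := h
      exact ⟨l', f, hf, ih _ _ h⟩

theorem free (n l : ℕ) : Module.FP S n (Fin l → S) := by
  induction n generalizing l with
  | zero => exact (inferInstance : Module.Finite S (Fin l → S))
  | succ n ih =>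
    refine succ_iff.2 ⟨l, LinearMap.id, Function.surjective_id, of_equiv ?_ (ih 0)⟩
    rw [LinearMap.ker_id]
    exact 0

theorem self (n : ℕ) : Module.FP S n S :=
  of_equiv (LinearEquiv.funUnique (Fin 1) S S) (free n 1)

theorem zero_of_extension {i : A →ₗ[S] B} {p : B →ₗ[S] C}
    (hip : Function.Exact i p) (hp : Function.Surjective p)
    (hA : Module.FP S 0 A) (hC : Module.FP S 0 C) : Module.FP S 0 B := by
  have : Module.Finite S A := hA
  have : Module.Finite S C := hC
  have h := Module.Finite.of_surjective i.rangeRestrict i.surjective_rangeRestrict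
  refine ⟨Submodule.fg_of_fg_map_of_fg_inf_ker p ?_ ?_⟩
  · rw [Submodule.map_top, LinearMap.range_eq_top.2 hp]
    exact Module.Finite.fg_top
  · rw [top_inf_eq, hip.linearMap_ker_eq]
    exact Module.Finite.iff_fg.1 h

/-- The horseshoe lemma in one degree: finite free covers of the outer terms of a short exact
sequence give one of the middle term, and the kernels form a short exact sequence. -/
theorem exists_horseshoe {S : Type u} [Ring S] [Module S A] [Module S B] [Module S C] {n : ℕ}
    {i : A →ₗ[S] B} {p : B →ₗ[S] C} (hi : Function.Injective i)
    (hip : Function.Exact i p) (hp : Function.Surjective p)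
    (hA : Module.FP S (n + 1) A) (hC : Module.FP S (n + 1) C) :
    ∃ (A' B' C' : Type u) (_ : AddCommGroup A') (_ : AddCommGroup B') (_ : AddCommGroup C')
      (_ : Module S A') (_ : Module S B') (_ : Module S C') (i' : A' →ₗ[S] B') (p' : B' →ₗ[S] C'),
      Function.Injective i' ∧ Function.Exact i' p' ∧ Function.Surjective p' ∧
      Module.FP S n A' ∧ Module.FP S n C' ∧ (Module.FP S n B' → Module.FP S (n + 1) B) := by
  obtain ⟨a, f, hf, hfK⟩ := succ_iff.1 hA
  obtain ⟨c, g, hg, hgK⟩ := succ_iff.1 hC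
  obtain ⟨s, hs⟩ := Module.projective_lifting_property p g hp
  have hs' : ∀ x, p (s x) = g x := fun x => LinearMap.congr_fun hs x
  have hpi : ∀ x, p (i x) = 0 := fun x => hip.apply_apply_eq_zero x
  let F : (Fin a → S) × (Fin c → S) →ₗ[S] B := (i ∘ₗ f).coprod s
  have hF : ∀ x, F x = i (f x.1) + s x.2 := fun x => by simp [F]
  refine ⟨LinearMap.ker f, LinearMap.ker F, LinearMap.ker g, inferInstance, inferInstance,
    inferInstance, inferInstance, inferInstance, inferInstance,
    LinearMap.restrict (LinearMap.inl S _ _) ?_, LinearMap.restrict (LinearMap.snd S _ _) ?_,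
    ?_, ?_, ?_, hfK, hgK, of_surjective (F := (Fin a → S) × (Fin c → S))
    ((LinearEquiv.funCongrLeft S S finSumFinEquiv).trans
      (LinearEquiv.sumArrowLequivProdArrow _ _ S S)) F ?_⟩
  · intro x hx
    rw [LinearMap.mem_ker] at hx ⊢
    simp [hF, hx]
  · intro x hx
    rw [LinearMap.mem_ker] at hx ⊢
    rw [hF] at hx
    have := congrArg p hx
    simpa [hs', hpi] using this
  · intro x y hxy
    have := congrArg Prod.fst (congrArg Subtype.val hxy)
    exact Subtype.ext this
  · rintro ⟨⟨x, y⟩, hxy⟩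
    constructor
    · intro h
      obtain rfl : y = 0 := congrArg Subtype.val h
      have hx : i (f x) = 0 := by simpa [hF] using hxy
      exact ⟨⟨x, hi (by rw [hx, map_zero])⟩, rfl⟩
    · rintro ⟨z, hz⟩
      have := congrArg Prod.snd (congrArg Subtype.val hz)
      exact Subtype.ext this.symm
  · rintro ⟨y, hy⟩
    obtain ⟨x', hx'⟩ := (hip (s y)).1 (by rw [hs']; exact hy)
    obtain ⟨x, rfl⟩ := hf x'
    refine ⟨⟨(-x, y), ?_⟩, rfl⟩
    rw [LinearMap.mem_ker, hF, map_neg, map_neg, hx', neg_add_cancel]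
  · intro b
    obtain ⟨y, hy⟩ := hg (p b)
    obtain ⟨x', hx'⟩ := (hip (b - s y)).1 (by rw [map_sub, hs', hy, sub_self])
    obtain ⟨x, rfl⟩ := hf x'
    exact ⟨(x, y), by rw [hF, hx']; abel⟩

/-- Type `FP_n` is closed under extensions. -/
theorem of_extension {n : ℕ} {i : A →ₗ[S] B} {p : B →ₗ[S] C}
    (hi : Function.Injective i) (hip : Function.Exact i p) (hp : Function.Surjective p)
    (hA : Module.FP S n A) (hC : Module.FP S n C) : Module.FP S n B := by
  cases n with
  | zero => exact zero_of_extension hip hp hA hC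
  | succ n =>
    -- One horseshoe step outside the induction moves all three modules into the universe of `S`,
    -- where the induction can stay.
    obtain ⟨A', B', C', _, _, _, _, _, _, i', p', hi', hip', hp', hA', hC', hB⟩ :=
      exists_horseshoe hi hip hp hA hC
    refine hB ?_
    clear hB
    induction n generalizing A' B' C' with
    | zero => exact zero_of_extension hip' hp' hA' hC'
    | succ n ih =>
      obtain ⟨A'', B'', C'', _, _, _, _, _, _, i'', p'', hi'', hip'', hp'', hA'', hC'', hB'⟩ :=
        exists_horseshoe hi' hip' hp' hA' hC'
      exact hB' (ih hA.of_succ hC.of_succ A'' B'' C'' _ _ _ _ _ _ i'' p'' hi'' hip'' hp'' hA'' hC'')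

/-- For a finite free cover `f` of `B`, the kernel of `p ∘ f` is an extension of `A` by `ker f`. -/
theorem of_cokernel {n : ℕ} {i : A →ₗ[S] B} {p : B →ₗ[S] C}
    (hi : Function.Injective i) (hip : Function.Exact i p) (hp : Function.Surjective p)
    (hA : Module.FP S n A) (hB : Module.FP S (n + 1) B) : Module.FP S (n + 1) C := by
  obtain ⟨b, f, hf, hfK⟩ := succ_iff.1 hB
  refine succ_iff.2 ⟨b, p ∘ₗ f, hp.comp hf, ?_⟩
  have hle : LinearMap.ker f ≤ LinearMap.ker (p ∘ₗ f) := LinearMap.ker_le_ker_comp f p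
  let e := LinearEquiv.ofInjective i hi
  have hmem : ∀ x : LinearMap.ker (p ∘ₗ f), f x ∈ LinearMap.range i := fun x =>
    (hip (f x)).1 x.2
  let q : LinearMap.ker (p ∘ₗ f) →ₗ[S] LinearMap.range i :=
    (f ∘ₗ (LinearMap.ker (p ∘ₗ f)).subtype).codRestrict _ hmem
  refine of_extension (i := Submodule.inclusion hle) (p := q)
    (Submodule.inclusion_injective hle) ?_ ?_ hfK (of_equiv e hA)
  · intro x
    constructor
    · intro h
      exact ⟨⟨x, congrArg Subtype.val h⟩, rfl⟩
    · rintro ⟨y, rfl⟩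
      exact Subtype.ext y.2
  · rintro ⟨_, y, rfl⟩
    obtain ⟨x, hx⟩ := hf (i y)
    refine ⟨⟨x, ?_⟩, Subtype.ext hx⟩
    rw [LinearMap.mem_ker, LinearMap.comp_apply, hx]
    exact hip.apply_apply_eq_zero y

/-- The pullback of `p` along a finite free cover `g` of `C` is an extension of `B` by `ker g`,
hence `FP_n`. It also splits as `A × S ^ c`, since `S ^ c` is projective, and `A` is recovered as a
quotient by `S ^ c`. In particular the choice of cover in the definition of `FP_n` does not matter.
-/
theorem of_kernel {n : ℕ} {i : A →ₗ[S] B} {p : B →ₗ[S] C}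
    (hi : Function.Injective i) (hip : Function.Exact i p) (hp : Function.Surjective p)
    (hB : Module.FP S n B) (hC : Module.FP S (n + 1) C) : Module.FP S n A := by
  obtain ⟨c, g, hg, hgK⟩ := succ_iff.1 hC
  obtain ⟨s, hs⟩ := Module.projective_lifting_property p g hp
  have hs' : ∀ x, p (s x) = g x := fun x => LinearMap.congr_fun hs x
  have hpi : ∀ x, p (i x) = 0 := fun x => hip.apply_apply_eq_zero x
  -- `A × S ^ c` is the pullback of `p` and `g`
  let F : A × (Fin c → S) →ₗ[S] B := i.coprod s
  have hF : ∀ x, F x = i x.1 + s x.2 := fun x => by simp [F]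
  have hk : ∀ y : LinearMap.ker g, s y ∈ LinearMap.range i := fun y =>
    (hip (s y)).1 (by rw [hs']; exact y.2)
  let e := LinearEquiv.ofInjective i hi
  have he : ∀ z, i (e.symm z) = z := fun z => congrArg Subtype.val (e.apply_symm_apply z)
  let t : LinearMap.ker g →ₗ[S] A :=
    e.symm.toLinearMap ∘ₗ (s ∘ₗ (LinearMap.ker g).subtype).codRestrict _ hk
  have ht : ∀ y, i (t y) = s y := fun y => he _
  have hX : Module.FP S n (A × (Fin c → S)) := by
    refine of_extension (i := (-t).prod (LinearMap.ker g).subtype) (p := F) ?_ ?_ ?_ hgK hB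
    · intro x y hxy
      exact Subtype.ext (congrArg Prod.snd hxy)
    · rintro ⟨x, y⟩
      constructor
      · intro h
        have hy : g y = 0 := by
          have := congrArg p h
          simpa [hF, hs', hpi] using this
        refine ⟨⟨y, hy⟩, Prod.ext (hi ?_) rfl⟩
        rw [hF] at h
        change i (-t _) = i x
        rw [map_neg, ht]
        exact (eq_neg_of_add_eq_zero_left h).symm
      · rintro ⟨y, hy⟩
        rw [← hy, hF]
        change i (-t y) + s y = 0
        rw [map_neg, ht, neg_add_cancel]
    · intro b
      obtain ⟨y, hy⟩ := hg (p b)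
      obtain ⟨x, hx⟩ := (hip (b - s y)).1 (by rw [map_sub, hs', hy, sub_self])
      exact ⟨(x, y), by rw [hF, hx]; abel⟩
  cases n with
  | zero =>
    have : Module.Finite S (A × (Fin c → S)) := hX
    exact Module.Finite.of_surjective (LinearMap.fst S A (Fin c → S)) Prod.fst_surjective
  | succ n =>
    refine of_cokernel (i := LinearMap.inr S A (Fin c → S)) (p := LinearMap.fst S A (Fin c → S))
      LinearMap.inr_injective ?_ Prod.fst_surjective (free n c) hX
    exact Function.Exact.inr_fst

/-- The kernel of `e` is the range of the idempotent `1 - e`, so the syzygies alternate between the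
two ranges. -/
theorem range_of_isIdempotentElem (n : ℕ) {l : ℕ} {e : Module.End S (Fin l → S)}
    (he : IsIdempotentElem e) : Module.FP S n (LinearMap.range e) := by
  induction n generalizing e with
  | zero => exact Module.Finite.range e
  | succ n ih =>
    refine of_cokernel (i := (LinearMap.range (1 - e)).subtype) (p := e.rangeRestrict)
      Subtype.val_injective ?_ e.surjective_rangeRestrict (ih he.one_sub) (free (n + 1) l)
    intro x
    constructor
    · intro hx
      have hx : e x = 0 := congrArg Subtype.val hx
      exact ⟨⟨x, x, by simp [hx]⟩, rfl⟩
    · rintro ⟨⟨_, y, rfl⟩, rfl⟩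
      have := LinearMap.congr_fun he.eq y
      refine Subtype.ext ?_
      change e (y - e y) = 0
      rw [map_sub, sub_eq_zero]
      exact this.symm

theorem of_projective (n : ℕ) [Module.Projective S A] [Module.Finite S A] : Module.FP S n A := by
  obtain ⟨l, f, hf⟩ := Module.Finite.exists_fin' S A
  obtain ⟨s, hs⟩ := Module.projective_lifting_property f LinearMap.id hf
  have hs' : ∀ x, f (s x) = x := fun x => LinearMap.congr_fun hs x
  have he : IsIdempotentElem (s ∘ₗ f : Module.End S (Fin l → S)) := by
    ext1 x
    simp [LinearMap.ext_iff, hs']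
  have hr : LinearMap.range (s ∘ₗ f) = LinearMap.range s := by
    rw [LinearMap.range_comp, LinearMap.range_eq_top.2 hf, Submodule.map_top]
  have h := range_of_isIdempotentElem n he
  rw [hr] at h
  exact of_equiv (LinearEquiv.ofInjective s (Function.LeftInverse.injective hs')).symm h

/-- If `A ≤ B ≤ I` with `A` of type `FP_n` and `B`, `I ⧸ A` of type `FP_{n+1}`, then `I` is of type
`FP_{n+1}`. -/
theorem of_submodules {n : ℕ} {I : Type*} [AddCommGroup I] [Module S I] {A B : Submodule S I}
    (hAB : A ≤ B) (hA : Module.FP S n A) (hB : Module.FP S (n + 1) B)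
    (hIA : Module.FP S (n + 1) (I ⧸ A)) : Module.FP S (n + 1) I := by
  have hL : Module.FP S (n + 1) (B.map A.mkQ) := by
    refine of_cokernel (i := Submodule.inclusion hAB)
      (p := A.mkQ.submoduleMap B) (Submodule.inclusion_injective hAB) ?_
      (LinearMap.submoduleMap_surjective _ _) hA hB
    intro x
    rw [← Subtype.coe_inj]
    change A.mkQ x = 0 ↔ _
    rw [Submodule.mkQ_apply, Submodule.Quotient.mk_eq_zero]
    exact ⟨fun h => ⟨⟨x, h⟩, rfl⟩, fun ⟨y, hy⟩ => hy ▸ y.2⟩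
  have hIB : Module.FP S (n + 1) (I ⧸ B) := of_equiv
    (Submodule.quotientQuotientEquivQuotient A B hAB)
    (of_cokernel (B.map A.mkQ).injective_subtype (LinearMap.exact_subtype_mkQ _)
      (Submodule.mkQ_surjective _) hL.of_succ hIA)
  exact of_extension B.injective_subtype (LinearMap.exact_subtype_mkQ B)
    B.mkQ_surjective hB hIB

theorem pi {n : ℕ} (h : Module.FP S n A) (l : ℕ) : Module.FP S n (Fin l → A) := by
  induction l with
  | zero => exact of_equiv 0 (free n 0)
  | succ l ih =>
    exact of_equiv (Fin.consLinearEquiv S fun _ : Fin (l + 1) => A)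
      (of_extension (LinearMap.inl_injective (R := S) (M := A) (M₂ := Fin l → A))
        Function.Exact.inl_snd Prod.snd_surjective h ih)

/-- One step of the restriction of scalars of a finite free resolution. -/
theorem exists_restrictScalars {R : Type*} [Ring R] [Module R S] [IsScalarTower R S S] {n : ℕ}
    (hS : Module.FP R (n + 1) S) [Module R A] [IsScalarTower R S A]
    (h : Module.FP S (n + 1) A) : ∃ (l : ℕ) (K : Submodule S (Fin l → S)),
      Module.FP S n K ∧ (Module.FP R n K → Module.FP R (n + 1) A) := by
  obtain ⟨l, f, hf, h⟩ := succ_iff.1 h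
  refine ⟨l, LinearMap.ker f, h, fun h => ?_⟩
  exact of_cokernel (i := (LinearMap.ker f).subtype.restrictScalars R) (p := f.restrictScalars R)
    Subtype.val_injective (LinearMap.exact_subtype_ker_map f) hf h (hS.pi l)

/-- Restriction of scalars to a ring over which `S` is of type `FP_n`. -/
theorem restrictScalars {R : Type*} [Ring R] [Module R S] [IsScalarTower R S S] {n : ℕ}
    (hS : Module.FP R n S) [Module R A] [IsScalarTower R S A]
    (h : Module.FP S n A) : Module.FP R n A := by
  cases n with
  | zero =>
    have : Module.Finite R S := hS
    have : Module.Finite S A := h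
    exact Module.Finite.trans S A
  | succ n =>
    obtain ⟨l, K, hK, hA⟩ := exists_restrictScalars hS h
    refine hA ?_
    clear hA
    replace hS := hS.of_succ
    induction n generalizing l with
    | zero =>
      have : Module.Finite R S := hS
      have : Module.Finite S K := hK
      exact Module.Finite.trans S K
    | succ n ih =>
      obtain ⟨l', K', hK', hK⟩ := exists_restrictScalars hS hK
      exact hK (ih h.of_succ l' K' hK' hS.of_succ)

/-- A module with a projective resolution that is finitely generated up to degree `n` is of type
`FP_n`. -/
theorem of_resolution {n : ℕ} {M : Type v} [AddCommGroup M] [Module S M] {X : ℕ → Type v}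
    [∀ i, AddCommGroup (X i)] [∀ i, Module S (X i)] (d : ∀ i, X (i + 1) →ₗ[S] X i)
    (ε : X 0 →ₗ[S] M) (hX : ∀ i, Module.Projective S (X i)) (hε : Function.Surjective ε)
    (h0 : Function.Exact (d 0) ε) (hd : ∀ i, Function.Exact (d (i + 1)) (d i))
    (hf : ∀ i ≤ n, Module.Finite S (X i)) : Module.FP S n M := by
  have := hX 0
  have := hf 0 (Nat.zero_le n)
  induction n generalizing M X with
  | zero => exact Module.Finite.of_surjective ε hε
  | succ n ih =>
    refine of_cokernel (LinearMap.ker ε).injective_subtype (LinearMap.exact_subtype_ker_map ε)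
      hε ?_ (of_projective (n + 1))
    have hmem : ∀ x, d 0 x ∈ LinearMap.ker ε := h0.apply_apply_eq_zero
    -- The shifted resolution resolves `ker ε`.
    refine ih (X := fun i => X (i + 1)) (fun i => d (i + 1)) ((d 0).codRestrict _ hmem)
      (fun i => hX (i + 1)) ?_ ?_ (fun i => hd (i + 1)) (fun i hi => hf (i + 1) (by lia)) (hX 1)
      (hf 1 (by lia))
    · rintro ⟨x, hx⟩
      obtain ⟨y, rfl⟩ := (h0 x).1 hx
      exact ⟨y, rfl⟩
    · intro x
      rw [← hd 0 x, ← Subtype.coe_inj]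
      rfl

end Module.FP

/-! ### Comparison with projective resolutions. -/

theorem LinearMap.exact_subtype_ker_comp {S M N P : Type*} [Ring S] [AddCommGroup M] [Module S M]
    [AddCommGroup N] [Module S N] [AddCommGroup P] [Module S P] (f : M →ₗ[S] N)
    {g : P →ₗ[S] LinearMap.ker f} (hg : Function.Surjective g) :
    Function.Exact ((LinearMap.ker f).subtype ∘ₗ g) f := fun x =>
  ⟨fun hx => (hg ⟨x, hx⟩).imp fun y hy => congrArg Subtype.val hy,
    fun ⟨y, hy⟩ => by rw [← hy]; exact (g y).2⟩

namespace ModuleProjectiveResolution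

variable {S : Type u} [Ring S]

/-- Splice a resolution of the kernel of a projective cover onto that cover. -/
def cons {M : Type (max u v)} [AddCommGroup M] [Module S M]
    {F : Type (max u v)} [AddCommGroup F] [Module S F] [Module.Projective S F]
    (f : F →ₗ[S] M) (hf : Function.Surjective f)
    (R : ModuleProjectiveResolution.{u, max u v} S (LinearMap.ker f)) :
    ModuleProjectiveResolution.{u, max u v} S M where
  X i := Nat.casesOn i F R.X
  addCommGroup i := by cases i <;> dsimp only <;> infer_instance
  module i := by cases i <;> dsimp only <;> infer_instance
  d i := by
    cases i with
    | zero => exact (LinearMap.ker f).subtype ∘ₗ R.ε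
    | succ i => exact R.d i
  ε := f
  projective i := by
    cases i with
    | zero => assumption
    | succ i => exact R.projective i
  surjective := hf
  exact_zero := f.exact_subtype_ker_comp R.surjective
  exact_succ i := by
    cases i with
    | zero => exact fun x => Subtype.val_injective.eq_iff' rfl |>.trans (R.exact_zero x)
    | succ i => exact R.exact_succ i

/-- Replace the resolved module by an isomorphic one. -/
def ofEquiv {M : Type (max u v)} [AddCommGroup M] [Module S M] {N : Type v} [AddCommGroup N]
    [Module S N] (e : M ≃ₗ[S] N) (R : ModuleProjectiveResolution.{u, max u v} S M) :
    ModuleProjectiveResolution.{u, v} S N where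
  X := R.X
  d := R.d
  ε := e.toLinearMap ∘ₗ R.ε
  projective := R.projective
  surjective := e.surjective.comp R.surjective
  exact_zero := fun x => (e.map_eq_zero_iff).trans (R.exact_zero x)
  exact_succ := R.exact_succ

/-- The kernel of the standard free cover of `M`. -/
noncomputable def standardKernel (M : ModuleCat.{max u v} S) : ModuleCat.{max u v} S :=
  ModuleCat.of S (LinearMap.ker (Finsupp.linearCombination S (id : M → M)))

/-- The first step of the standard free presentation of `M`. -/
noncomputable def standardMap (M : ModuleCat.{max u v} S) :
    (standardKernel M →₀ S) →ₗ[S] (M →₀ S) :=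
  (LinearMap.ker (Finsupp.linearCombination S (id : M → M))).subtype ∘ₗ
    Finsupp.linearCombination S (id : standardKernel M → standardKernel M)

theorem standardMap_exact (M : ModuleCat.{max u v} S) :
    Function.Exact (standardMap M) (Finsupp.linearCombination S (id : M → M)) :=
  LinearMap.exact_subtype_ker_comp _
    (Finsupp.linearCombination_id_surjective S (standardKernel M))

theorem standardMap_exact_standardMap (M : ModuleCat.{max u v} S) :
    Function.Exact (standardMap (standardKernel M)) (standardMap M) := fun x =>
  (Subtype.val_injective.eq_iff' rfl).trans (standardMap_exact (standardKernel M) x)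

/-- The syzygies of the standard free resolution of `M`. -/
noncomputable def standardSyzygy (M : ModuleCat.{max u v} S) : ℕ → ModuleCat.{max u v} S
  | 0 => M
  | i + 1 => standardKernel (standardSyzygy M i)

/-- The standard free resolution. -/
noncomputable def standard (M : Type (max u v)) [AddCommGroup M] [Module S M] :
    ModuleProjectiveResolution.{u, max u v} S M where
  X i := standardSyzygy (ModuleCat.of S M) i →₀ S
  d i := standardMap (standardSyzygy (ModuleCat.of S M) i)
  ε := Finsupp.linearCombination S (id : M → M)
  projective _ := inferInstance
  surjective := Finsupp.linearCombination_id_surjective S M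
  exact_zero := standardMap_exact (ModuleCat.of S M)
  exact_succ i := standardMap_exact_standardMap (standardSyzygy (ModuleCat.of S M) i)

end ModuleProjectiveResolution

/-- By `of_kernel`, the kernel of any finite free cover drops the type by exactly one, so covers can
be spliced up to degree `n`. Beyond that no finiteness is required and the standard free resolution
takes over. -/
theorem Module.FP.exists_resolution {S : Type u} [Ring S] {n : ℕ} {M : Type (max u v)}
    [AddCommGroup M] [Module S M] (h : Module.FP S n M) :
    ∃ R : ModuleProjectiveResolution.{u, max u v} S M, ∀ i ≤ n, Module.Finite S (R.X i) := by
  obtain ⟨l, f', hf'⟩ := @Module.Finite.exists_fin' S M _ _ _ h.finite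
  let f : ULift.{v} (Fin l → S) →ₗ[S] M := f' ∘ₗ ULift.moduleEquiv.toLinearMap
  have hf : Function.Surjective f := hf'.comp ULift.moduleEquiv.surjective
  induction n generalizing M l with
  | zero =>
    refine ⟨.cons f hf (.standard _), fun i hi => ?_⟩
    obtain rfl := Nat.le_zero.1 hi
    exact Module.Finite.equiv (ULift.moduleEquiv (R := S) (M := Fin l → S)).symm
  | succ n ih =>
    have hK : Module.FP S n (LinearMap.ker f) := Module.FP.of_kernel
      (LinearMap.ker f).injective_subtype (LinearMap.exact_subtype_ker_map f) hf
      (Module.FP.of_equiv ULift.moduleEquiv.symm (Module.FP.free n l)) h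
    obtain ⟨l', g', hg'⟩ := @Module.Finite.exists_fin' S _ _ _ _ hK.finite
    obtain ⟨R, hR⟩ := ih hK l' g' hg' (hg'.comp ULift.moduleEquiv.surjective)
    refine ⟨.cons f hf R, fun i hi => ?_⟩
    cases i with
    | zero => exact Module.Finite.equiv (ULift.moduleEquiv (R := S) (M := Fin l → S)).symm
    | succ i => exact hR i (by lia)

theorem moduleOfTypeFP_iff {S : Type u} [Ring S] {n : ℕ} {M : Type v} [AddCommGroup M]
    [Module S M] : ModuleOfTypeFP S M n ↔ Module.FP S n M := by
  constructor
  · rintro ⟨R, hR⟩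
    refine Module.FP.of_equiv (ULift.moduleEquiv.{_, _, u} (R := S) (M := M)) ?_
    refine Module.FP.of_resolution R.d (ULift.moduleEquiv.symm.toLinearMap ∘ₗ R.ε) R.projective
      (ULift.moduleEquiv.symm.surjective.comp R.surjective) ?_ R.exact_succ hR
    exact fun x => (ULift.moduleEquiv.symm.map_eq_zero_iff).trans (R.exact_zero x)
  · intro h
    obtain ⟨R, hR⟩ := (Module.FP.of_equiv (ULift.moduleEquiv.{_, _, u} (R := S) (M := M)).symm
      h).exists_resolution
    exact ⟨R.ofEquiv ULift.moduleEquiv, hR⟩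

/-! ### Flat base change. -/

/-- Coordinates of a ring `R'` along a ring homomorphism `φ : R → R'` which makes `R'` a free right
`R`-module: `x = ∑ t, b t * φ (c x t)`. -/
structure RightCoordinates {R R' : Type*} [Ring R] [Ring R'] (φ : R →+* R') (T : Type*) where
  /-- the basis -/
  b : T → R'
  /-- the coordinates -/
  c : R' →+ (T →₀ R)
  mul_map : ∀ x r t, c (x * φ r) t = c x t * r
  sum_eq : ∀ x, ((c x).sum fun t r => b t * φ r) = x

namespace RingHom

variable {R R' T : Type*} [Ring R] [Ring R'] (φ : R →+* R')

/-- The extension of scalars of a map of free modules, i.e. the image of its matrix. -/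
def extendMap {k l : ℕ} (f : (Fin l → R) →ₗ[R] (Fin k → R)) : (Fin l → R') →ₗ[R'] (Fin k → R') :=
  Fintype.linearCombination R' fun i => φ ∘ f (Pi.single i 1)

/-- The submodule of `R' ^ k` generated by the image of a submodule of `R ^ k`. -/
def extendSubmodule {k : ℕ} (K : Submodule R (Fin k → R)) : Submodule R' (Fin k → R') :=
  Submodule.span R' ((φ ∘ ·) '' (K : Set (Fin k → R)))

theorem extendMap_apply {k l : ℕ} (f : (Fin l → R) →ₗ[R] (Fin k → R)) (v : Fin l → R') (j : Fin k) :
    φ.extendMap f v j = ∑ i, v i * φ (f (Pi.single i 1) j) := by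
  simp [extendMap, Fintype.linearCombination_apply]

theorem map_apply_eq_sum {k l : ℕ} (f : (Fin l → R) →ₗ[R] (Fin k → R)) (v : Fin l → R) (j : Fin k) :
    f v j = ∑ i, v i * f (Pi.single i 1) j := by
  conv_lhs => rw [pi_eq_sum_univ' v, map_sum, Finset.sum_apply]
  refine Finset.sum_congr rfl fun i _ => ?_
  rw [map_smul, Pi.smul_apply, smul_eq_mul]

theorem extendMap_comp {k l : ℕ} (f : (Fin l → R) →ₗ[R] (Fin k → R)) (v : Fin l → R) :
    φ.extendMap f (φ ∘ v) = φ ∘ f v := by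
  ext j
  rw [extendMap_apply, Function.comp_apply, map_apply_eq_sum f v j, map_sum]
  simp

theorem range_extendMap {k l : ℕ} (f : (Fin l → R) →ₗ[R] (Fin k → R)) :
    LinearMap.range (φ.extendMap f) = φ.extendSubmodule (LinearMap.range f) := by
  apply le_antisymm
  · rintro _ ⟨v, rfl⟩
    rw [extendMap, Fintype.linearCombination_apply]
    exact Submodule.sum_mem _ fun i _ => Submodule.smul_mem _ _
      (Submodule.subset_span ⟨_, ⟨_, rfl⟩, rfl⟩)
  · refine Submodule.span_le.2 ?_
    rintro _ ⟨_, ⟨v, rfl⟩, rfl⟩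
    exact ⟨φ ∘ v, φ.extendMap_comp f v⟩

/-- This is exactness of `R' ⊗_R -`. The matrix of `f` acts by right multiplication, which the
coordinates respect, so each coordinate vector of a kernel element lies in `ker f`; `sum_eq`
reassembles the element from them. -/
theorem ker_extendMap {φ : R →+* R'} (h : RightCoordinates φ T) {k l : ℕ}
    (f : (Fin l → R) →ₗ[R] (Fin k → R)) :
    LinearMap.ker (φ.extendMap f) = φ.extendSubmodule (LinearMap.ker f) := by
  classical
  apply le_antisymm
  · intro v hv
    have hc : ∀ t, (fun i => h.c (v i) t) ∈ LinearMap.ker f := by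
      intro t
      ext j
      have := DFunLike.congr_fun (congrArg h.c (congrFun hv j)) t
      rw [extendMap_apply, map_sum, Finsupp.finsetSum_apply] at this
      rw [map_apply_eq_sum]
      simpa [h.mul_map] using this
    let s : Finset T := Finset.univ.biUnion fun i => (h.c (v i)).support
    have hv' : v = ∑ t ∈ s, h.b t • (φ ∘ fun i => h.c (v i) t) := by
      ext i
      rw [Finset.sum_apply]
      conv_lhs => rw [← h.sum_eq (v i)]
      refine Finsupp.sum_of_support_subset _ ?_ _ (by simp)
      exact Finset.subset_biUnion_of_mem (fun i => (h.c (v i)).support) (Finset.mem_univ i)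
    rw [hv']
    exact Submodule.sum_mem _ fun t _ => Submodule.smul_mem _ _
      (Submodule.subset_span ⟨_, hc t, rfl⟩)
  · refine Submodule.span_le.2 ?_
    rintro _ ⟨v, hv, rfl⟩
    have hv : f v = 0 := hv
    change φ.extendMap f (φ ∘ v) = 0
    rw [extendMap_comp, hv]
    ext
    simp

theorem extendSubmodule_fg {k : ℕ} {K : Submodule R (Fin k → R)} (hK : K.FG) :
    (φ.extendSubmodule K).FG := by
  have := Module.Finite.iff_fg.2 hK
  obtain ⟨l, f, hf⟩ := Module.Finite.exists_fin' R K
  have : K = LinearMap.range (K.subtype ∘ₗ f) := by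
    rw [LinearMap.range_comp, LinearMap.range_eq_top.2 hf, Submodule.map_top,
      Submodule.range_subtype]
  rw [this, ← range_extendMap]
  exact Module.Finite.iff_fg.1 inferInstance

/-- Flat base change preserves type `FP_n`. -/
theorem syzygyFP_extendSubmodule {φ : R →+* R'} (h : RightCoordinates φ T) {n k : ℕ}
    {K : Submodule R (Fin k → R)} (hK : K.SyzygyFP n) : (φ.extendSubmodule K).SyzygyFP n := by
  induction n generalizing k with
  | zero => exact φ.extendSubmodule_fg hK
  | succ n ih =>
    obtain ⟨l, f, rfl, hf⟩ := hK
    refine ⟨l, φ.extendMap f, φ.range_extendMap f, ?_⟩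
    rw [ker_extendMap h]
    exact ih hf

theorem fp_map_ideal {φ : R →+* R'} (h : RightCoordinates φ T) {n : ℕ}
    {I : Ideal R} (hI : Module.FP R n I) : Module.FP R' n (I.map φ) := by
  let e := LinearEquiv.funUnique (Fin 1) R R
  let e' := LinearEquiv.funUnique (Fin 1) R' R'
  have h1 := syzygyFP_extendSubmodule h ((Module.FP.syzygyFP_iff _).2
    (Module.FP.of_equiv (e.symm.submoduleMap I) hI))
  refine Module.FP.of_equiv (e'.ofSubmodules _ _ ?_) ((Module.FP.syzygyFP_iff _).1 h1)
  rw [extendSubmodule, Submodule.map_span, Ideal.map, Ideal.span]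
  congr 1
  ext x
  constructor
  · rintro ⟨_, ⟨_, ⟨y, hy, rfl⟩, rfl⟩, rfl⟩
    exact ⟨y, hy, rfl⟩
  · rintro ⟨y, hy, rfl⟩
    exact ⟨_, ⟨_, ⟨y, hy, rfl⟩, rfl⟩, rfl⟩

end RingHom

/-! ### Group rings and augmentation ideals. -/

namespace MonoidAlgebra

/-- If `H → G` is an injective group homomorphism, then `k[G]` is a free right `k[H]`-module on a
transversal of the left cosets. -/
noncomputable def rightCoordinates (k : Type*) [CommRing k] {H G : Type*} [Group H] [Group G]
    {f : H →* G} (hf : Function.Injective f) :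
    RightCoordinates (mapDomainRingHom k f) (G ⧸ f.range) := by
  -- Each `g` is its coset representative times some `f (r g)`; the coordinate of `g` is `r g`,
  -- placed at its coset.
  have hex : ∀ g : G, ∃ h : H, (QuotientGroup.mk g : G ⧸ f.range).out * f h = g := fun g => by
    obtain ⟨⟨_, h, rfl⟩, hh⟩ := QuotientGroup.mk_out_eq_mul f.range g
    exact ⟨h⁻¹, by rw [hh]; simp⟩
  choose r hr using hex
  have hmk : ∀ g h, (QuotientGroup.mk (g * f h) : G ⧸ f.range) = QuotientGroup.mk g := fun g h =>
    QuotientGroup.mk_mul_of_mem _ ⟨h, rfl⟩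
  have hmul : ∀ g h, r (g * f h) = r g * h := fun g h => by
    apply hf
    have h1 := hr (g * f h)
    rw [hmk] at h1
    refine mul_left_cancel (h1.trans ?_)
    rw [map_mul, ← mul_assoc, hr]
  let c : MonoidAlgebra k G →+ (G ⧸ f.range →₀ MonoidAlgebra k H) :=
    (Finsupp.liftAddHom fun g => (Finsupp.singleAddHom (QuotientGroup.mk g)).comp
      (singleAddHom (r g))).comp coeffAddEquiv.toAddMonoidHom
  have hc : ∀ g a, c (single g a) = Finsupp.single (QuotientGroup.mk g) (single (r g) a) :=
    fun g a => by simp [c]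
  refine ⟨fun t => single t.out 1, c, ?_, ?_⟩
  · intro x y t
    induction x using MonoidAlgebra.induction_linear with
    | zero => simp
    | add x x' hx hx' => simp only [add_mul, map_add, Finsupp.add_apply, hx, hx']
    | single g a =>
      induction y using MonoidAlgebra.induction_linear with
      | zero => simp
      | add y y' hy hy' => simp only [mul_add, map_add, Finsupp.add_apply, hy, hy']
      | single h b =>
        rw [mapDomainRingHom_apply, mapDomain_single, single_mul_single, hc, hc, hmk, hmul,
          ← single_mul_single]
        classical
        rw [Finsupp.single_apply, Finsupp.single_apply, ite_mul, zero_mul]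
  · intro x
    induction x using MonoidAlgebra.induction_linear with
    | zero => simp
    | add x x' hx hx' =>
      rw [map_add, Finsupp.sum_add_index', hx, hx']
      · simp
      · exact fun _ _ _ => by rw [map_add, mul_add]
    | single g a =>
      rw [hc, Finsupp.sum_single_index (by simp), mapDomainRingHom_apply, mapDomain_single,
        single_mul_single, hr, one_mul]

/-- The augmentation `ℤ[G] → ℤ`. -/
noncomputable def augmentation (G : Type*) [Group G] : MonoidAlgebra ℤ G →+* ℤ :=
  (lift ℤ ℤ G 1).toRingHom

@[simp]
theorem augmentation_single {G : Type*} [Group G] (g : G) (a : ℤ) :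
    augmentation G (single g a) = a := by
  simp [augmentation]

/-- The augmentation ideal of `ℤ[G]`, as a left ideal. -/
noncomputable def augmentationIdeal (G : Type*) [Group G] : Ideal (MonoidAlgebra ℤ G) :=
  RingHom.ker (augmentation G)

section

variable {H G : Type*} [Group H] [Group G] (f : H →* G)

theorem augmentation_mapDomain (x : MonoidAlgebra ℤ H) :
    augmentation G (mapDomainRingHom ℤ f x) = augmentation H x := by
  induction x using MonoidAlgebra.induction_linear with
  | zero => simp
  | add x y hx hy => rw [map_add, map_add, map_add, hx, hy]
  | single g a => simp

theorem mapDomain_mem_augmentationIdeal {x : MonoidAlgebra ℤ H} :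
    mapDomainRingHom ℤ f x ∈ augmentationIdeal G ↔ x ∈ augmentationIdeal H := by
  rw [augmentationIdeal, RingHom.mem_ker, augmentation_mapDomain]
  rfl

theorem map_augmentationIdeal_le :
    (augmentationIdeal H).map (mapDomainRingHom ℤ f) ≤ augmentationIdeal G :=
  Ideal.span_le.2 fun _ ⟨_, hx, h⟩ => h ▸ (mapDomain_mem_augmentationIdeal f).2 hx

theorem mapDomainRingHom_surjective (hf : Function.Surjective f) :
    Function.Surjective (mapDomainRingHom ℤ f) := by
  intro x
  induction x using MonoidAlgebra.induction_linear with
  | zero => exact ⟨0, map_zero _⟩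
  | add x y hx hy =>
    obtain ⟨x, rfl⟩ := hx
    obtain ⟨y, rfl⟩ := hy
    exact ⟨x + y, map_add _ _ _⟩
  | single g a =>
    obtain ⟨h, rfl⟩ := hf g
    exact ⟨single h a, by simp⟩

/-- The kernel of `ℤ[H] → ℤ[G]` is the left ideal generated by the augmentation ideal of the
kernel of `H → G`. -/
theorem ker_mapDomainRingHom {N : Type*} [Group N] (i : N →* H) (hi : f.ker = i.range) :
    RingHom.ker (mapDomainRingHom ℤ f) = (augmentationIdeal N).map (mapDomainRingHom ℤ i) := by
  apply le_antisymm
  · intro x hx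
    -- Modulo the ideal, each `h` equals the representative `s (f h)` of its coset, so `x` is
    -- congruent to the image under `s` of its image in `ℤ[G]`, which vanishes.
    let s : G → H := Function.invFun f
    have hs : ∀ h, f (s (f h)) = f h := fun h => Function.invFun_eq ⟨h, rfl⟩
    have key : ∀ x : MonoidAlgebra ℤ H, x - mapDomain s (mapDomainRingHom ℤ f x) ∈
        (augmentationIdeal N).map (mapDomainRingHom ℤ i) := by
      intro x
      induction x using MonoidAlgebra.induction_linear with
      | zero => simp
      | add x y hx hy =>
        rw [map_add, mapDomain_add, add_sub_add_comm]
        exact add_mem hx hy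
      | single h a =>
        obtain ⟨n, hn⟩ : (s (f h))⁻¹ * h ∈ i.range := by
          rw [← hi, MonoidHom.mem_ker, map_mul, map_inv, hs, inv_mul_cancel]
        have : single h a - mapDomain s (mapDomainRingHom ℤ f (single h a)) =
            single (s (f h)) a * mapDomainRingHom ℤ i (single n 1 - 1) := by
          rw [map_sub, map_one, mul_sub, mul_one]
          simp [hn]
        rw [this]
        refine Ideal.mul_mem_left _ _ (Ideal.mem_map_of_mem _ ?_)
        rw [augmentationIdeal, RingHom.mem_ker, map_sub, map_one, augmentation_single, sub_self]
    have := key x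
    rwa [RingHom.mem_ker.1 hx, mapDomain_zero, sub_zero] at this
  · refine Ideal.span_le.2 ?_
    rintro _ ⟨x, hx, rfl⟩
    change mapDomainRingHom ℤ f (mapDomainRingHom ℤ i x) = 0
    have hfi : ∀ n, f (i n) = 1 := fun n => by
      rw [← MonoidHom.mem_ker, hi]
      exact ⟨n, rfl⟩
    have : ∀ x, mapDomainRingHom ℤ f (mapDomainRingHom ℤ i x) = single 1 (augmentation N x) := by
      intro x
      induction x using MonoidAlgebra.induction_linear with
      | zero => simp
      | add x y hx hy => rw [map_add, map_add, map_add, hx, hy, single_add]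
      | single n a => simp [hfi]
    rw [this, RingHom.mem_ker.1 hx, single_zero]

end

end MonoidAlgebra

/-! ### Groups of type `FP_n` and the fibre product. -/

open MonoidAlgebra

/-- Dimension shift along `0 → I → ℤG → ℤ → 0`, whose middle term is free of rank one. -/
theorem groupOfTypeFP_succ_iff {G : Type*} [Group G] {n : ℕ} :
    GroupOfTypeFP G (n + 1) ↔ Module.FP (MonoidAlgebra ℤ G) n (augmentationIdeal G) := by
  rw [GroupOfTypeFP, moduleOfTypeFP_iff]
  let ε : MonoidAlgebra ℤ G →ₗ[MonoidAlgebra ℤ G] (Representation.trivial ℤ G ℤ).asModule :=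
    LinearMap.toSpanSingleton _ _ (1 : ℤ)
  let e : (Representation.trivial ℤ G ℤ).asModule ≃ₗ[ℤ] ℤ := Representation.asModuleEquiv _
  have hε : ∀ x, e (ε x) = augmentation G x := by
    intro x
    induction x using MonoidAlgebra.induction_linear with
    | zero => simp
    | add x y hx hy => rw [map_add, map_add, map_add, hx, hy]
    | single g a =>
      rw [augmentation_single]
      change e (single g a • e.symm 1) = a
      rw [Representation.single_smul]
      exact mul_one a
  have hsurj : Function.Surjective ε := fun a =>
    ⟨single 1 (e a), e.injective (by rw [hε, augmentation_single])⟩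
  have hexact : Function.Exact (augmentationIdeal G).subtype ε := by
    intro x
    rw [← e.map_eq_zero_iff, hε]
    exact ⟨fun h => ⟨⟨x, h⟩, rfl⟩, fun ⟨y, hy⟩ => by rw [← hy]; exact y.2⟩
  exact ⟨Module.FP.of_kernel (Submodule.injective_subtype _) hexact hsurj (Module.FP.self n),
    fun h => Module.FP.of_cokernel (Submodule.injective_subtype _) hexact hsurj h
      (Module.FP.self (n + 1))⟩

/-- Let `N → G → K` be a short exact sequence of groups with `N` of type `FP_n` and `K` of type
`FP_{n+1}`. If `N` is contained in a subgroup `H` of `G` of type `FP_{n+1}`, then `G` is of type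
`FP_{n+1}`. -/
theorem groupOfTypeFP_of_extension_of_subgroup {N H G K : Type*} [Group N] [Group H] [Group G]
    [Group K] {n : ℕ} {i : N →* H} {j : H →* G} {p : G →* K} (hi : Function.Injective i)
    (hj : Function.Injective j) (hp : Function.Surjective p) (hker : p.ker = (j.comp i).range)
    (hN : GroupOfTypeFP N (n + 1)) (hH : GroupOfTypeFP H (n + 2)) (hK : GroupOfTypeFP K (n + 2)) :
    GroupOfTypeFP G (n + 2) := by
  rw [groupOfTypeFP_succ_iff] at hN hH hK ⊢
  have hji : Function.Injective (j.comp i) := hj.comp hi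
  let ψ := mapDomainRingHom ℤ p
  let A := (augmentationIdeal N).map (mapDomainRingHom ℤ (j.comp i))
  let B := (augmentationIdeal H).map (mapDomainRingHom ℤ j)
  let I := augmentationIdeal G
  have hA : Module.FP (MonoidAlgebra ℤ G) n A := RingHom.fp_map_ideal (rightCoordinates ℤ hji) hN
  have hB : Module.FP (MonoidAlgebra ℤ G) (n + 1) B :=
    RingHom.fp_map_ideal (rightCoordinates ℤ hj) hH
  have hAI : A ≤ I := map_augmentationIdeal_le _
  have hBI : B ≤ I := map_augmentationIdeal_le _
  have hAB : A ≤ B := by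
    refine Ideal.span_le.2 ?_
    rintro _ ⟨x, hx, rfl⟩
    rw [mapDomainRingHom_comp]
    exact Ideal.mem_map_of_mem _ ((mapDomain_mem_augmentationIdeal i).2 hx)
  have hψ : ∀ x, ψ x = 0 ↔ x ∈ A := fun x => by
    rw [← RingHom.mem_ker, ker_mapDomainRingHom p (j.comp i) hker]
  let _ : Module (MonoidAlgebra ℤ G) (MonoidAlgebra ℤ K) := Module.compHom _ ψ
  have : IsScalarTower (MonoidAlgebra ℤ G) (MonoidAlgebra ℤ K) (MonoidAlgebra ℤ K) :=
    ⟨fun x y z => mul_assoc (ψ x) y z⟩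
  let Ψ : MonoidAlgebra ℤ G →ₗ[MonoidAlgebra ℤ G] MonoidAlgebra ℤ K :=
    { toFun := ψ
      map_add' := map_add ψ
      map_smul' := map_mul ψ }
  -- `ℤK` is `ℤG ⧸ A`, and passing to a cokernel gains one degree over `A`.
  have hS : Module.FP (MonoidAlgebra ℤ G) (n + 1) (MonoidAlgebra ℤ K) :=
    Module.FP.of_cokernel (i := A.subtype) (p := Ψ) (Submodule.injective_subtype _)
      (fun x => (hψ x).trans ⟨fun h => ⟨⟨x, h⟩, rfl⟩, fun ⟨y, hy⟩ => by rw [← hy]; exact y.2⟩)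
      (mapDomainRingHom_surjective p hp) hA (Module.FP.self (n + 2)).of_succ
  have hIK : Module.FP (MonoidAlgebra ℤ G) (n + 1) (augmentationIdeal K) := hS.restrictScalars hK
  let q : I →ₗ[MonoidAlgebra ℤ G] augmentationIdeal K :=
    { toFun := fun x => ⟨ψ x, (mapDomain_mem_augmentationIdeal p).2 x.2⟩
      map_add' := fun x y => Subtype.ext (map_add ψ _ _)
      map_smul' := fun x y => Subtype.ext (map_mul ψ _ _) }
  have hq : Function.Surjective q := by
    rintro ⟨y, hy⟩
    obtain ⟨x, rfl⟩ := mapDomainRingHom_surjective p hp y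
    exact ⟨⟨x, (mapDomain_mem_augmentationIdeal p).1 hy⟩, rfl⟩
  have hqA : LinearMap.ker q = A.submoduleOf I := by
    ext x
    exact (Subtype.val_injective.eq_iff' rfl).symm.trans (hψ x)
  refine Module.FP.of_submodules (A := A.submoduleOf I) (B := B.submoduleOf I)
    (Submodule.comap_mono hAB)
    (Module.FP.of_equiv (Submodule.submoduleOfEquivOfLe hAI).symm hA)
    (Module.FP.of_equiv (Submodule.submoduleOfEquivOfLe hBI).symm hB) ?_
  rw [← hqA]
  exact Module.FP.of_equiv (q.quotKerEquivOfSurjective hq).symm hIK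

theorem theoremB {N₁ G₁ N₂ G₂ Q : Type*} [Group N₁] [Group G₁] [Group N₂] [Group G₂] [Group Q]
    (n : ℕ) (hn : 1 ≤ n)
    (E₁ : GroupExtension N₁ G₁ Q) (E₂ : GroupExtension N₂ G₂ Q)
    (hG₁ : GroupOfTypeFP G₁ (n + 1)) (hG₂ : GroupOfTypeFP G₂ (n + 1))
    (hN₁ : GroupOfTypeFP N₁ n)
    (hsplit : Nonempty E₂.Splitting) :
    GroupOfTypeFP (fibreProduct E₁.rightHom E₂.rightHom) (n + 1) := by
  obtain ⟨n, rfl⟩ := Nat.exists_eq_add_of_le' hn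
  obtain ⟨s⟩ := hsplit
  -- The graph of `σ ∘ π₁`; on `N₁` it is `m ↦ (m, 1)`, whose image is the whole kernel of `p`.
  let j : G₁ →* fibreProduct E₁.rightHom E₂.rightHom :=
    ((MonoidHom.id G₁).prod ((s : Q →* G₂).comp E₁.rightHom)).codRestrict _
      fun g => (s.rightHom_splitting (E₁.rightHom g)).symm
  let p : fibreProduct E₁.rightHom E₂.rightHom →* G₂ :=
    (MonoidHom.snd G₁ G₂).comp (Subgroup.subtype _)
  refine groupOfTypeFP_of_extension_of_subgroup (i := E₁.inl) (j := j) (p := p)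
    E₁.inl_injective ?_ ?_ ?_ hN₁ hG₁ hG₂
  · exact fun x y h => congrArg (fun z => z.1.1) h
  · intro y
    obtain ⟨x, hx⟩ := E₁.rightHom_surjective (E₂.rightHom y)
    exact ⟨⟨(x, y), hx⟩, rfl⟩
  · ext ⟨⟨x, y⟩, hxy⟩
    constructor
    · intro h
      obtain rfl : y = 1 := h
      have hx : x ∈ E₁.rightHom.ker :=
        (show E₁.rightHom x = E₂.rightHom 1 from hxy).trans (map_one _)
      rw [← E₁.range_inl_eq_ker_rightHom] at hx
      obtain ⟨m, rfl⟩ := hx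
      refine ⟨m, Subtype.ext (Prod.ext rfl ?_)⟩
      change s (E₁.rightHom (E₁.inl m)) = 1
      rw [E₁.rightHom_inl, map_one]
    · rintro ⟨m, hm⟩
      have : s (E₁.rightHom (E₁.inl m)) = y := congrArg (fun z => z.1.2) hm
      rw [E₁.rightHom_inl, map_one] at this
      exact this.symm
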